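/- Consider a typical user at the origin of $\mathbb{R}^2$ and caching helpers located at the points $x_k$ of a homogeneous Poisson point process $\Phi$ of intensity $\lambda>0$. There are $F$ contents. Each helper stores a random set of at most $M$ contents that contains content $i$ with probability $p_i\in[0,1]$. The channel from the helper at $x_k$ to the user has path-loss exponent $\alpha>2$ and a Nakagami-$m_D$ fading coefficient $h_k$ with $m_D\ge\frac12$, i.e. $|h_k|^2$ has density $\frac{m_D^{m_D}}{\Gamma(m_D)}x^{m_D-1}e^{-m_Dx}$ on $x\ge 0$. The stored sets and the fading coefficients of all helpers are mutually independent and independent of $\Phi$. Let $P>0$ be the transmit power, $\sigma^2>0$ the noise power and $\eta=P/\sigma^2$. For each content $i$ let $$\xi_{i,1}=\inf\Big\{\frac{|x_k|^{\alpha}}{|h_k|^2} : \text{helper } k \text{ stores content } i\Big\}$$ be the smallest reciprocal of the instantaneous channel power gain ($\xi_{i,1}=\infty$ if no helper stores $i$); a user requesting content $i$ is served by the helper attaining this infimum, i.e. the one with the largest instantaneous channel power gain, and in the noise-limited network the mutual information is $R_i=\log_2\left(1+\eta/\xi_{i,1}\right)$. Let $f_i\ge 0$, $\sum_{i=1}^F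 f_i=1$, be the probability that content $i$ is requested, and let $\rho_i>0$ be its target bit rate. **Theorem.** For every $i$ with $p_i>0$ the infimum $\xi_{i,1}$ is almost surely attained, so that a serving helper exists, and the average content delivery success probability $P_s=\sum_{i=1}^F f_i\,\mathbb{P}[R_i\ge\rho_i]$ equals $$P_s = 1-\sum_{i=1}^F f_i \exp\left(-\kappa\, p_i\left(\frac{\eta}{2^{\rho_i}-1}\right)^{\delta}\right),\qquad \kappa=\pi\lambda\,\frac{\Gamma(\delta+m_D)}{m_D^{\delta}\,\Gamma(m_D)},\quad \delta=\frac{2}{\alpha}.$$ -/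

import Mathlib

open MeasureTheory ProbabilityTheory
open scoped NNReal ENNReal

noncomputable section

/-- The Euclidean plane; the typical user sits at its origin. -/
abbrev Plane : Type := EuclideanSpace ℝ (Fin 2)

/-- The number (possibly infinite) of points of the enumerated configuration `x` lying in `A`. -/
def pointCount (x : ℕ → Plane) (A : Set Plane) : ℕ∞ := Set.encard {k : ℕ | x k ∈ A}

/-- `X` is a measurable enumeration of the points of a homogeneous Poisson point process on the
plane with intensity `lam`: the number of points in a Borel set `A` of finite area is Poisson with
mean `lam * area A`, and the numbers of points in disjoint Borel sets are independent. -/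
structure IsHomogeneousPPP {Ω : Type*} [MeasurableSpace Ω] (μ : Measure Ω) (lam : ℝ≥0)
    (X : ℕ → Ω → Plane) : Prop where
  measurable : ∀ k, Measurable (X k)
  hasLaw_count : ∀ A : Set Plane, MeasurableSet A → volume A ≠ ∞ →
    HasLaw (fun ω => pointCount (fun k => X k ω) A)
      ((poissonMeasure (lam * (volume A).toNNReal)).map (Nat.cast : ℕ → ℕ∞)) μ
  indep_count : ∀ (n : ℕ) (A : Fin n → Set Plane), (∀ j, MeasurableSet (A j)) →
    Pairwise (fun i j => Disjoint (A i) (A j)) →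
    iIndepFun (fun j ω => pointCount (fun k => X k ω) (A j)) μ

/-- The random caching network. Helper `k` is located at `X k`, stores the set `C k` of contents
(the library is `Fin F`), and its channel to the typical user has fading coefficient `h k`.

* The locations form a homogeneous Poisson point process with intensity `lam`.
* Each helper stores at most `M` contents, and stores content `i` with probability `p i`; nothing
  else is prescribed about the joint law of the contents stored in the same helper.
* The fading is Nakagami-`m`: the power gain `‖h k‖ ^ 2` has density
  `m ^ m / Γ(m) * x ^ (m - 1) * exp (- m * x)` on `x ≥ 0`.
* Different helpers choose their caches and fade independently, the cache of a helper is
  independent of its fading, and all of this is independent of the locations. -/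
structure IsCachingNetwork {Ω : Type*} [MeasurableSpace Ω] (μ : Measure Ω) {F : ℕ} (M : ℕ)
    (lam : ℝ≥0) (m : ℝ) (p : Fin F → ℝ)
    (X : ℕ → Ω → Plane) (C : ℕ → Ω → Set (Fin F)) (h : ℕ → Ω → ℂ) : Prop where
  locations : IsHomogeneousPPP μ lam X
  measurable_cache : ∀ k, Measurable (C k)
  measurable_fading : ∀ k, Measurable (h k)
  cache_size : ∀ k, ∀ᵐ ω ∂μ, (C k ω).ncard ≤ M
  cache_prob : ∀ k i, μ.real {ω | i ∈ C k ω} = p i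
  fading_law : ∀ k, HasLaw (fun ω => ‖h k ω‖ ^ 2) (gammaMeasure m m) μ
  indep_cache_fading : ∀ k, IndepFun (C k) (h k) μ
  indep_helpers : iIndepFun (fun k ω => (C k ω, h k ω)) μ
  indep_locations : IndepFun (fun ω k => X k ω) (fun ω k => (C k ω, h k ω)) μ

/-- Instantaneous channel power gain `|h|² |x|^{-α}` of a helper located at `x` with fading
coefficient `h`. -/
def powerGain (α : ℝ) (x : Plane) (h : ℂ) : ℝ≥0∞ := ‖h‖ₑ ^ 2 * ‖x‖ₑ ^ (-α)

/-- Helper `k` is a serving helper for content `i` (in the configuration with locations `x`, caches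
`c` and fading coefficients `h`): it stores `i`, and it has the largest instantaneous channel power
gain among the helpers that store `i`. -/
def IsServingHelper {F : ℕ} (α : ℝ) (x : ℕ → Plane) (c : ℕ → Set (Fin F)) (h : ℕ → ℂ)
    (i : Fin F) (k : ℕ) : Prop :=
  i ∈ c k ∧ ∀ j, i ∈ c j → powerGain α (x j) (h j) ≤ powerGain α (x k) (h k)

/-- The smallest reciprocal channel power gain among the helpers that store content `i`; it is `∞`
if no helper stores `i`. -/
def minRecipGain {F : ℕ} (α : ℝ) (x : ℕ → Plane) (c : ℕ → Set (Fin F)) (h : ℕ → ℂ)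
    (i : Fin F) : ℝ≥0∞ :=
  ⨅ (k : ℕ) (_ : i ∈ c k), (powerGain α (x k) (h k))⁻¹

/-- Mutual information `log₂ (1 + η / ξ)` at signal-to-noise ratio `η` and reciprocal channel power
gain `ξ`; it is `0` at `ξ = ∞` and `∞` at `ξ = 0`. -/
def mutualInfo (η : ℝ) (ξ : ℝ≥0∞) : EReal :=
  ENNReal.log (1 + ENNReal.ofReal η / ξ) / ((Real.log 2 : ℝ) : EReal)

/-- Average content delivery success probability `∑ i, f i * ℙ[R i ≥ ρ i]` in the noise-limited
network, where `R i` is the mutual information between the typical user and the helper with the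
largest instantaneous channel power gain among those that store content `i`. -/
def avgSuccessProb {Ω : Type*} [MeasurableSpace Ω] (μ : Measure Ω) {F : ℕ} (α η : ℝ)
    (f ρ : Fin F → ℝ) (X : ℕ → Ω → Plane) (C : ℕ → Ω → Set (Fin F)) (h : ℕ → Ω → ℂ) : ℝ :=
  ∑ i, f i * μ.real {ω | (ρ i : EReal) ≤
    mutualInfo η (minRecipGain α (fun k => X k ω) (fun k => C k ω) (fun k => h k ω) i)}

/-- The constant `κ = π λ Γ(δ + m) / (m ^ δ Γ(m))`. -/
def kappa (lam m δ : ℝ) : ℝ :=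
  Real.pi * lam * (Real.Gamma (δ + m) / (m ^ δ * Real.Gamma m))

end

/-! Fix a content `i` and a threshold `T`. Call a helper good if it stores `i` and its reciprocal
power gain is at most `T`. Given the locations, the helpers are good independently of one another,
a helper at `x` with probability `q x = p i * ℙ (gain at x ≥ 1 / T)`. Hence the probability that no
helper is good is the expectation of `∏ k, (1 - q (X k))`, the probability generating functional of
the Poisson process, which is `exp (-lam * ∫ q)`. By Tonelli, `∫ q` is `p i` times the mean area of
the disc `‖x‖ ^ α ≤ T * ‖h‖ ^ 2`, that is `π * T ^ δ` times the moment of order `δ = 2 / α` of the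
Gamma distribution (`lintegral_gainTail`). This gives `exp (-κ * p i * T ^ δ)`
(`IsCachingNetwork.measure_forall_notMem_goodSet`).

The generating functional (`IsHomogeneousPPP.lintegral_iInf_prod_one_sub`) is computed from the
joint law of the counts. For simple `q` the product over all points is a finite product of powers of
independent Poisson variables; the general case follows by monotone approximation. The infinite
product is written as the infimum of its partial products, so that this approximation only
interchanges two infima.

The infimum `ξ` is attained because, by Campbell's formula and Borel–Cantelli, almost surely only
finitely many helpers are good at each of the thresholds `T = n + 1`
(`IsCachingNetwork.ae_finite_goodSet`), while the void probability tends to `0` as `T → ∞` if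
`0 < p i`. The same finiteness identifies `ξ ≤ T` with the existence of a good helper
(`minRecipGain_le_ofReal_iff`), and `R ≥ ρ` means `ξ ≤ η / (2 ^ ρ - 1)`. -/

open Filter Topology

/-! ### Poisson variables, intensity and generating functional of the point process -/

lemma lintegral_poissonMeasure (r : ℝ≥0) (g : ℕ → ℝ≥0∞) :
    ∫⁻ n, g n ∂(poissonMeasure r) =
      ∑' n : ℕ, ENNReal.ofReal (Real.exp (-r) * r ^ n / n.factorial) * g n := by
  simp [poissonMeasure, lintegral_sum_measure]

/-- The probability generating function of the Poisson distribution, at `1 - a`. -/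
lemma lintegral_poissonMeasure_one_sub_pow (r : ℝ≥0) {a : ℝ≥0∞} (ha : a ≤ 1) :
    ∫⁻ n, (1 - a) ^ n ∂(poissonMeasure r) = ENNReal.ofReal (Real.exp (-(r * a.toReal))) := by
  lift a to ℝ≥0 using (ha.trans_lt ENNReal.one_lt_top).ne
  have ha' : (a : ℝ) ≤ 1 := by exact_mod_cast ha
  have h1 : (1 - (a : ℝ≥0∞)) = ENNReal.ofReal (1 - (a : ℝ)) := by
    rw [ENNReal.ofReal_sub _ a.coe_nonneg]; simp
  have hs : HasSum (fun n : ℕ => Real.exp (-r) * ((r * (1 - a) : ℝ) ^ n / n.factorial))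
      (Real.exp (-r) * Real.exp (r * (1 - a))) := by
    have := (NormedSpace.expSeries_div_hasSum_exp (r * (1 - a) : ℝ)).mul_left (Real.exp (-r))
    rwa [← Real.exp_eq_exp_ℝ] at this
  have h0 : ∀ n : ℕ, 0 ≤ Real.exp (-r) * ((r * (1 - a) : ℝ) ^ n / n.factorial) := fun n => by
    have : 0 ≤ 1 - (a : ℝ) := sub_nonneg.2 ha'
    positivity
  rw [lintegral_poissonMeasure]
  calc _ = ∑' n : ℕ, ENNReal.ofReal (Real.exp (-r) * ((r * (1 - a) : ℝ) ^ n / n.factorial)) := by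
        refine tsum_congr fun n => ?_
        rw [h1, ← ENNReal.ofReal_pow (sub_nonneg.2 ha'), ← ENNReal.ofReal_mul (by positivity),
          mul_pow]
        congr 1; ring
    _ = _ := by
        rw [← ENNReal.ofReal_tsum_of_nonneg h0 hs.summable, hs.tsum_eq, ← Real.exp_add]
        congr 2; simp; ring

lemma lintegral_cast_poissonMeasure (r : ℝ≥0) :
    ∫⁻ n, (n : ℝ≥0∞) ∂(poissonMeasure r) = r := by
  have hs : HasSum (fun n : ℕ => Real.exp (-r) * r * ((r : ℝ) ^ n / n.factorial)) r := by
    have := (NormedSpace.expSeries_div_hasSum_exp (r : ℝ)).mul_left (Real.exp (-r) * r)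
    rwa [← Real.exp_eq_exp_ℝ, mul_right_comm, ← Real.exp_add, neg_add_cancel, Real.exp_zero,
      one_mul] at this
  rw [lintegral_poissonMeasure, tsum_eq_zero_add' ENNReal.summable]
  simp only [Nat.cast_zero, mul_zero, zero_add]
  calc _ = ∑' n : ℕ, ENNReal.ofReal (Real.exp (-r) * r * ((r : ℝ) ^ n / n.factorial)) := by
        refine tsum_congr fun n => ?_
        rw [← ENNReal.ofReal_natCast, ← ENNReal.ofReal_mul (by positivity), Nat.factorial_succ]
        congr 1
        push_cast
        field_simp
        ring
    _ = _ := by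
        rw [← ENNReal.ofReal_tsum_of_nonneg (fun n => by positivity) hs.summable, hs.tsum_eq]
        simp

lemma toENNReal_pointCount (x : ℕ → Plane) (A : Set Plane) :
    (pointCount x A : ℝ≥0∞) = ∑' k, A.indicator 1 (x k) := by
  rw [pointCount, ← ENNReal.tsum_set_one, tsum_subtype {k | x k ∈ A} (fun _ => (1 : ℝ≥0∞))]
  rfl

section PPP

variable {Ω : Type*} [MeasurableSpace Ω] {μ : Measure Ω} {lam : ℝ≥0} {X : ℕ → Ω → Plane}

lemma measurable_pointCount (hX : ∀ k, Measurable (X k)) {A : Set Plane} (hA : MeasurableSet A) :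
    Measurable fun ω => pointCount (fun k => X k ω) A := by
  have h : Measurable fun ω => (pointCount (fun k => X k ω) A : ℝ≥0∞) := by
    simp_rw [toENNReal_pointCount]
    exact Measurable.tsum fun k => (measurable_one.indicator hA).comp (hX k)
  refine measurable_to_countable' fun n => ?_
  convert h (measurableSet_singleton (n : ℝ≥0∞)) using 1
  ext ω
  simp

namespace IsHomogeneousPPP

/-- The intensity measure `∑ k, law (X k)` is `lam` times the Lebesgue measure. -/
theorem sum_map_eq (hX : IsHomogeneousPPP μ lam X) :
    Measure.sum (fun k => μ.map (X k)) = (lam : ℝ≥0∞) • volume := by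
  have key : ∀ A : Set Plane, MeasurableSet A → volume A ≠ ∞ →
      Measure.sum (fun k => μ.map (X k)) A = lam * volume A := by
    intro A hA hfin
    have hc := (hX.hasLaw_count A hA hfin).lintegral_comp (f := fun n => (n : ℝ≥0∞))
      Measurable.of_discrete.aemeasurable
    simp_rw [toENNReal_pointCount] at hc
    rw [lintegral_map .of_discrete .of_discrete,
      lintegral_tsum (f := fun k ω => A.indicator (1 : Plane → ℝ≥0∞) (X k ω))
        fun k => ((measurable_one.indicator hA).comp (hX.measurable k)).aemeasurable] at hc
    simp only [ENat.toENNReal_coe, lintegral_cast_poissonMeasure] at hc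
    rw [Measure.sum_apply _ hA]
    calc _ = ∑' k, ∫⁻ ω, A.indicator 1 (X k ω) ∂μ := by
          refine tsum_congr fun k => ?_
          rw [← lintegral_map (measurable_one.indicator hA) (hX.measurable k),
            lintegral_indicator_one hA]
      _ = _ := by rw [hc]; simp [hfin]
  ext A hA
  -- The counts only determine the measure of sets of finite area, so exhaust `A` by bounded sets.
  have hU : A = ⋃ n : ℕ, A ∩ Metric.closedBall 0 n := by
    rw [← Set.inter_iUnion, Metric.iUnion_closedBall_nat, Set.inter_univ]
  have hmono : Monotone fun n : ℕ => A ∩ Metric.closedBall (0 : Plane) n := fun i j hij =>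
    Set.inter_subset_inter_right _ (Metric.closedBall_subset_closedBall (by exact_mod_cast hij))
  rw [hU, hmono.measure_iUnion, hmono.measure_iUnion]
  refine iSup_congr fun n => ?_
  rw [key _ (hA.inter measurableSet_closedBall)
    (measure_ne_top_of_subset Set.inter_subset_right measure_closedBall_lt_top.ne)]
  simp

/-- Campbell's formula. -/
theorem tsum_lintegral (hX : IsHomogeneousPPP μ lam X) {q : Plane → ℝ≥0∞} (hq : Measurable q) :
    ∑' k, ∫⁻ ω, q (X k ω) ∂μ = lam * ∫⁻ x, q x := by
  calc _ = ∫⁻ x, q x ∂(Measure.sum fun k => μ.map (X k)) := by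
        rw [lintegral_sum_measure]
        exact tsum_congr fun k => (lintegral_map hq (hX.measurable k)).symm
    _ = _ := by rw [hX.sum_map_eq, lintegral_smul_measure, smul_eq_mul]

/-- The probability generating functional for a simple function `q`: the product over all points
is a finite product of powers whose exponents are the independent Poisson counts of the points in
the level sets of `q`. -/
theorem lintegral_iInf_prod_one_sub_simpleFunc [IsProbabilityMeasure μ]
    (hX : IsHomogeneousPPP μ lam X)
    {q : SimpleFunc Plane ℝ≥0∞} (hq1 : ∀ x, q x ≤ 1) (hfin : ∫⁻ x, q x ≠ ∞) :
    ∫⁻ ω, ⨅ n : ℕ, ∏ k ∈ Finset.range n, (1 - q (X k ω)) ∂μ =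
      ENNReal.ofReal (Real.exp (-(lam * (∫⁻ x, q x).toReal))) := by
  classical
  -- The value `0` contributes factors `1`, and its level set may have infinite area.
  set S : Finset ℝ≥0∞ := q.range.erase 0 with hS
  have hS1 : ∀ a ∈ S, a ≤ 1 := by
    intro a ha
    obtain ⟨x, rfl⟩ := SimpleFunc.mem_range.1 (Finset.mem_of_mem_erase ha)
    exact hq1 x
  have hvol : ∀ a ∈ S, volume (q ⁻¹' {a}) ≠ ∞ := fun a ha =>
    ((SimpleFunc.FinMeasSupp.of_lintegral_ne_top
      (by rwa [← SimpleFunc.lintegral_eq_lintegral])).meas_preimage_singleton_ne_zero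
      (Finset.ne_of_mem_erase ha)).ne
  have hmeas : ∀ a, MeasurableSet (q ⁻¹' {a}) := fun a => q.measurableSet_fiber a
  let N : ℝ≥0∞ → Ω → ℕ∞ := fun a ω => pointCount (fun k => X k ω) (q ⁻¹' {a})
  have hNfin : ∀ᵐ ω ∂μ, ∀ a ∈ S, N a ω ≠ ⊤ := by
    refine (ae_ball_iff S.countable_toSet).2 fun a ha => ?_
    rw [(hX.hasLaw_count _ (hmeas a) (hvol a ha)).ae_iff (p := fun n => n ≠ ⊤)
      Measurable.of_discrete, ae_map_iff Measurable.of_discrete.aemeasurable .of_discrete]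
    simp
  have hprod : ∀ᵐ ω ∂μ, ⨅ n : ℕ, ∏ k ∈ Finset.range n, (1 - q (X k ω)) =
      ∏ a ∈ S, (1 - a) ^ (N a ω).toNat := by
    filter_upwards [hNfin] with ω hω
    have hanti : Antitone fun n : ℕ => ∏ k ∈ Finset.range n, (1 - q (X k ω)) :=
      antitone_nat_of_succ_le fun n => by
        rw [Finset.prod_range_succ]
        exact mul_le_of_le_one_right' tsub_le_self
    refine tendsto_nhds_unique (tendsto_atTop_iInf hanti) (tendsto_const_nhds.congr' ?_)
    -- From some `n` on, the first `n` points include all points of the finitely many level sets.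
    have hev : ∀ᶠ n in atTop, ∀ a ∈ S, ∀ k, q (X k ω) = a → k < n := by
      rw [Finset.eventually_all]
      intro a ha
      have hf : {k | q (X k ω) = a}.Finite := Set.encard_ne_top_iff.1 (hω a ha)
      obtain ⟨b, hb⟩ := hf.bddAbove
      filter_upwards [eventually_gt_atTop b] with n hn k hk
      exact (hb hk).trans_lt hn
    filter_upwards [hev] with n hn
    symm
    calc ∏ k ∈ Finset.range n, (1 - q (X k ω))
        = ∏ a ∈ q.range, ∏ k ∈ Finset.range n with q (X k ω) = a, (1 - q (X k ω)) :=
          (Finset.prod_fiberwise_of_maps_to (fun k _ => q.mem_range_self _) _).symm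
      _ = ∏ a ∈ q.range, (1 - a) ^ (Finset.card {k ∈ Finset.range n | q (X k ω) = a}) := by
          refine Finset.prod_congr rfl fun a _ => Finset.prod_eq_pow_card fun k hk => ?_
          rw [(Finset.mem_filter.1 hk).2]
      _ = ∏ a ∈ S, (1 - a) ^ (Finset.card {k ∈ Finset.range n | q (X k ω) = a}) :=
          (Finset.prod_erase _ (by simp)).symm
      _ = _ := by
          refine Finset.prod_congr rfl fun a ha => ?_
          have : N a ω = (({k ∈ Finset.range n | q (X k ω) = a} : Finset ℕ) : Set ℕ).encard := by
            refine congrArg Set.encard ?_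
            ext k
            simpa using hn a ha k
          rw [this, Set.encard_coe_eq_coe_finsetCard, ENat.toNat_natCast]
  have hind : iIndepFun (fun (a : S) ω => N a ω) μ := by
    have := hX.indep_count S.card (fun j => q ⁻¹' {(S.equivFin.symm j : ℝ≥0∞)})
      (fun j => hmeas _) (fun i j hij => ?_)
    · simpa [N] using this.precomp S.equivFin.injective
    · refine Disjoint.preimage _ (Set.disjoint_singleton.2 fun h => hij ?_)
      exact S.equivFin.symm.injective (Subtype.ext h)
  rw [lintegral_congr_ae hprod]
  simp_rw [← Finset.prod_coe_sort S]
  rw [lintegral_prod_eq_prod_lintegral_of_indepFun Finset.univ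
    (fun (a : S) ω => (1 - (a : ℝ≥0∞)) ^ (N a ω).toNat)
    (hind.comp (fun (a : S) (n : ℕ∞) => (1 - (a : ℝ≥0∞)) ^ n.toNat)
      fun a => Measurable.of_discrete)
    (fun a => (Measurable.of_discrete (f := fun n : ℕ∞ => (1 - (a : ℝ≥0∞)) ^ n.toNat)).comp
      (measurable_pointCount hX.measurable (hmeas a)))]
  have hpgf : ∀ a : S, ∫⁻ ω, (1 - (a : ℝ≥0∞)) ^ (N a ω).toNat ∂μ =
      ENNReal.ofReal (Real.exp (-(lam * (a * volume (q ⁻¹' {(a : ℝ≥0∞)})).toReal))) := by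
    intro a
    rw [(hX.hasLaw_count _ (hmeas a) (hvol a a.2)).lintegral_comp
      (f := fun n : ℕ∞ => (1 - (a : ℝ≥0∞)) ^ n.toNat) Measurable.of_discrete.aemeasurable,
      lintegral_map .of_discrete .of_discrete]
    simp only [ENat.toNat_natCast]
    rw [lintegral_poissonMeasure_one_sub_pow _ (hS1 a a.2), ENNReal.toReal_mul]
    congr 3
    push_cast [ENNReal.coe_toNNReal_eq_toReal]
    ring
  simp_rw [hpgf]
  rw [← ENNReal.ofReal_prod_of_nonneg fun _ _ => (Real.exp_pos _).le, ← Real.exp_sum,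
    Finset.sum_neg_distrib, ← Finset.mul_sum, SimpleFunc.lintegral_eq_lintegral,
    SimpleFunc.lintegral, ← Finset.sum_erase q.range (a := 0) (by simp), ← hS,
    ENNReal.toReal_sum fun a ha =>
      ENNReal.mul_ne_top ((hS1 a ha).trans_lt ENNReal.one_lt_top).ne (hvol a ha),
    Finset.sum_coe_sort S (fun a => (a * volume (q ⁻¹' {a})).toReal)]

/-- The probability generating functional of a homogeneous Poisson point process. -/
theorem lintegral_iInf_prod_one_sub [IsProbabilityMeasure μ] (hX : IsHomogeneousPPP μ lam X)
    {q : Plane → ℝ≥0∞} (hq : Measurable q) (hq1 : ∀ x, q x ≤ 1) (hfin : ∫⁻ x, q x ≠ ∞) :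
    ∫⁻ ω, ⨅ n : ℕ, ∏ k ∈ Finset.range n, (1 - q (X k ω)) ∂μ =
      ENNReal.ofReal (Real.exp (-(lam * (∫⁻ x, q x).toReal))) := by
  let s : ℕ → SimpleFunc Plane ℝ≥0∞ := SimpleFunc.eapprox q
  have hmono : Monotone s := SimpleFunc.monotone_eapprox q
  have hsup : ∀ x, ⨆ j, s j x = q x := SimpleFunc.iSup_eapprox_apply hq
  have hle : ∀ j x, s j x ≤ q x := fun j x => hsup x ▸ le_iSup (fun j => s j x) j
  have htend : ∀ x, Tendsto (fun j => s j x) atTop (𝓝 (q x)) := fun x =>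
    hsup x ▸ tendsto_atTop_iSup fun i j hij => hmono hij x
  have hanti : ∀ ω n, Antitone fun j => ∏ k ∈ Finset.range n, (1 - s j (X k ω)) :=
    fun ω n i j hij => Finset.prod_le_prod' fun k _ => tsub_le_tsub_left (hmono hij _) _
  have hswap : ∀ ω, ⨅ n : ℕ, ∏ k ∈ Finset.range n, (1 - q (X k ω)) =
      ⨅ j, ⨅ n : ℕ, ∏ k ∈ Finset.range n, (1 - s j (X k ω)) := by
    intro ω
    rw [iInf_comm]
    refine iInf_congr fun n => ?_
    refine tendsto_nhds_unique ?_ (tendsto_atTop_iInf (hanti ω n))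
    exact ENNReal.tendsto_finsetProd_of_ne_top _
      (fun k _ => ENNReal.Tendsto.sub tendsto_const_nhds (htend _) (.inl ENNReal.one_ne_top))
      (fun k _ => (tsub_le_self.trans_lt ENNReal.one_lt_top).ne)
  have hfin' : ∀ j, ∫⁻ x, s j x ≠ ∞ := fun j => ne_top_of_le_ne_top hfin (lintegral_mono (hle j))
  simp_rw [hswap]
  rw [lintegral_iInf]
  · simp_rw [hX.lintegral_iInf_prod_one_sub_simpleFunc (fun x => (hle _ x).trans (hq1 x)) (hfin' _)]
    have hint : Tendsto (fun j => ∫⁻ x, s j x) atTop (𝓝 (∫⁻ x, q x)) :=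
      lintegral_tendsto_of_tendsto_of_monotone (fun j => (s j).measurable.aemeasurable)
        (ae_of_all _ fun x i j hij => hmono hij x) (ae_of_all _ htend)
    refine tendsto_nhds_unique (tendsto_atTop_iInf fun i j hij => ?_) (ENNReal.tendsto_ofReal
      ((Real.continuous_exp.tendsto _).comp
        (((ENNReal.tendsto_toReal hfin).comp hint).const_mul (lam : ℝ)).neg))
    refine ENNReal.ofReal_le_ofReal (Real.exp_le_exp.2 (neg_le_neg ?_))
    exact mul_le_mul_of_nonneg_left
      (ENNReal.toReal_mono (hfin' j) (lintegral_mono (hmono hij))) lam.2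
  · intro j
    exact Measurable.iInf fun n => Finset.measurable_fun_prod _ fun k _ =>
      measurable_const.sub ((s j).measurable.comp (hX.measurable k))
  · exact fun i j hij ω => iInf_mono fun n => hanti ω n hij
  · refine ne_top_of_le_ne_top ENNReal.one_ne_top ?_
    calc _ ≤ ∫⁻ _, 1 ∂μ := lintegral_mono fun ω => (iInf_le _ 0).trans (by simp)
      _ = 1 := by simp

end IsHomogeneousPPP

end PPP

/-! ### The mean area covered at a given gain threshold -/

/-- The moment of order `s` of the Gamma distribution. -/
lemma lintegral_rpow_gammaMeasure {a r s : ℝ} (ha : 0 < a) (hr : 0 < r) (hs : 0 < s) :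
    ∫⁻ u, ENNReal.ofReal u ^ s ∂(gammaMeasure a r) =
      ENNReal.ofReal (Real.Gamma (s + a) / (r ^ s * Real.Gamma a)) := by
  have hG : 0 < Real.Gamma a := Real.Gamma_pos_of_pos ha
  have hsa : 0 < s + a := by positivity
  have hmeas : Measurable fun u : ℝ => ENNReal.ofReal u ^ s := by fun_prop
  have hpdf : Measurable (gammaPDF a r) := (measurable_gammaPDFReal a r).ennreal_ofReal
  have hint := Real.integral_rpow_mul_exp_neg_mul_Ioi hsa hr
  have hpos : 0 < (1 / r) ^ (s + a) * Real.Gamma (s + a) :=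
    mul_pos (by positivity) (Real.Gamma_pos_of_pos hsa)
  rw [gammaMeasure, lintegral_withDensity_eq_lintegral_mul _ hpdf hmeas]
  calc ∫⁻ u, (gammaPDF a r * fun u => ENNReal.ofReal u ^ s) u
      = ∫⁻ u in Set.Ioi 0, (gammaPDF a r * fun u => ENNReal.ofReal u ^ s) u := by
        refine (setLIntegral_eq_of_support_subset fun u hu => ?_).symm
        by_contra hu0
        exact hu (by simp [ENNReal.ofReal_of_nonpos (not_lt.1 hu0), hs])
    _ = ∫⁻ u in Set.Ioi 0, ENNReal.ofReal (r ^ a / Real.Gamma a) *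
          ENNReal.ofReal (u ^ (s + a - 1) * Real.exp (-(r * u))) := by
        refine setLIntegral_congr_fun measurableSet_Ioi fun u (hu : 0 < u) => ?_
        rw [Pi.mul_apply, gammaPDF_of_nonneg hu.le, ENNReal.ofReal_rpow_of_pos hu,
          ← ENNReal.ofReal_mul (by positivity), ← ENNReal.ofReal_mul (by positivity), add_sub_assoc,
          Real.rpow_add hu]
        congr 1; ring
    _ = _ := by
        rw [lintegral_const_mul' _ _ ENNReal.ofReal_ne_top, ← ofReal_integral_eq_lintegral_ofReal,
          hint, ← ENNReal.ofReal_mul (by positivity)]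
        · congr 1
          rw [one_div, Real.inv_rpow hr.le, Real.rpow_add hr]
          field_simp
        -- A nonintegrable function would have integral `0`, but the integral is positive.
        · exact not_not.1 fun h => hpos.ne' (hint ▸ integral_undef h)
        · exact (ae_restrict_iff' measurableSet_Ioi).2 (ae_of_all _ fun u (hu : 0 < u) => by
            simp only [Pi.zero_apply]; positivity)

/-- The locations at which a channel with squared fading `v` has gain at least `t` form a disc. -/
lemma volume_setOf_le_mul_rpow_neg {α : ℝ} (hα : 0 < α) {t v : ℝ≥0∞} (ht : t ≠ 0) (ht' : t ≠ ∞)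
    (hv : v ≠ ∞) :
    volume {x : Plane | t ≤ v * ‖x‖ₑ ^ (-α)} = ENNReal.ofReal Real.pi * (v / t) ^ (2 / α) := by
  rcases eq_or_ne v 0 with rfl | hv0
  · simp [ht, hα]
  have hvt : (v / t) ^ α⁻¹ ≠ ∞ :=
    ENNReal.rpow_ne_top_of_nonneg (by positivity) (ENNReal.div_ne_top hv ht)
  have hball : {x : Plane | t ≤ v * ‖x‖ₑ ^ (-α)} =
      Metric.closedBall 0 ((v / t) ^ α⁻¹).toReal := by
    -- This includes `x = 0`, where `‖x‖ₑ ^ (-α) = ∞` and `v ≠ 0`.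
    ext x
    rw [Set.mem_ofPred_eq, mem_closedBall_zero_iff, ← ENNReal.ofReal_le_iff_le_toReal hvt,
      ofReal_norm, ENNReal.le_rpow_inv_iff hα, ENNReal.rpow_neg, ← div_eq_mul_inv,
      ENNReal.le_div_iff_mul_le (.inr hv0) (.inr hv), ENNReal.le_div_iff_mul_le (.inl ht) (.inl ht'),
      mul_comm]
  rw [hball, EuclideanSpace.volume_closedBall_fin_two, ENNReal.ofReal_toReal hvt, mul_comm,
    ← ENNReal.rpow_natCast, ← ENNReal.rpow_mul]
  congr 2
  push_cast
  ring

/-- The probability that a helper at `x` with Nakagami-`m` fading has power gain at least `t`. -/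
noncomputable def gainTail (α m : ℝ) (t : ℝ≥0∞) (x : Plane) : ℝ≥0∞ :=
  gammaMeasure m m {u | t ≤ ENNReal.ofReal u * ‖x‖ₑ ^ (-α)}

lemma measurableSet_gain_le (α : ℝ) (t : ℝ≥0∞) :
    MeasurableSet {z : Plane × ℝ | t ≤ ENNReal.ofReal z.2 * ‖z.1‖ₑ ^ (-α)} :=
  measurableSet_le measurable_const (by fun_prop)

lemma measurable_gainTail (α : ℝ) {m : ℝ} (hm : 0 < m) (t : ℝ≥0∞) :
    Measurable (gainTail α m t) := by
  have := isProbabilityMeasure_gammaMeasure hm hm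
  exact measurable_measure_prodMk_left (measurableSet_gain_le α t)

lemma gainTail_le_one (α : ℝ) {m : ℝ} (hm : 0 < m) (t : ℝ≥0∞) (x : Plane) :
    gainTail α m t x ≤ 1 := by
  have := isProbabilityMeasure_gammaMeasure hm hm
  exact prob_le_one

/-- The mean area covered: by Tonelli, average the area of the disc over the fading. -/
lemma lintegral_gainTail {α m T : ℝ} (hα : 0 < α) (hm : 0 < m) (hT : 0 < T) :
    ∫⁻ x, gainTail α m (ENNReal.ofReal T)⁻¹ x = ENNReal.ofReal (Real.pi *
      (Real.Gamma (2 / α + m) / (m ^ (2 / α) * Real.Gamma m)) * T ^ (2 / α)) := by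
  have := isProbabilityMeasure_gammaMeasure hm hm
  have hmeas := measurableSet_gain_le α (ENNReal.ofReal T)⁻¹
  have hδ : 0 < 2 / α := by positivity
  have hG : 0 < Real.Gamma m := Real.Gamma_pos_of_pos hm
  have hG' : 0 < Real.Gamma (2 / α + m) := Real.Gamma_pos_of_pos (by positivity)
  calc ∫⁻ x, gainTail α m (ENNReal.ofReal T)⁻¹ x
      = ∫⁻ u, volume {x : Plane | (ENNReal.ofReal T)⁻¹ ≤ ENNReal.ofReal u * ‖x‖ₑ ^ (-α)}
          ∂(gammaMeasure m m) :=
        (Measure.prod_apply hmeas).symm.trans (Measure.prod_apply_symm hmeas)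
    _ = ∫⁻ u, (ENNReal.ofReal Real.pi * ENNReal.ofReal T ^ (2 / α)) *
          ENNReal.ofReal u ^ (2 / α) ∂(gammaMeasure m m) := by
        refine lintegral_congr fun u => ?_
        rw [volume_setOf_le_mul_rpow_neg hα (by simp) (by simpa using hT) ENNReal.ofReal_ne_top,
          div_eq_mul_inv, inv_inv, ENNReal.mul_rpow_of_nonneg _ _ hδ.le]
        ring
    _ = _ := by
        rw [lintegral_const_mul _ (by fun_prop), lintegral_rpow_gammaMeasure hm hm hδ,
          ENNReal.ofReal_rpow_of_pos hT, ← ENNReal.ofReal_mul Real.pi_pos.le,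
          ← ENNReal.ofReal_mul (by positivity)]
        congr 1; ring

/-! ### Deterministic properties of a configuration -/

section Deterministic

variable {F : ℕ} {α : ℝ} {x : ℕ → Plane} {c : ℕ → Set (Fin F)} {h : ℕ → ℂ} {i : Fin F}

/-- A serving helper exists if only finitely many helpers that store `i` have a gain above any
given positive level, and one of them has a positive gain. -/
lemma exists_isServingHelper
    (hfin : ∀ n : ℕ, {k | i ∈ c k ∧
      (ENNReal.ofReal ((n : ℝ) + 1))⁻¹ ≤ powerGain α (x k) (h k)}.Finite)
    {k₀ : ℕ} (hk₀ : i ∈ c k₀) (hpos : powerGain α (x k₀) (h k₀) ≠ 0) :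
    ∃ k, IsServingHelper α x c h i k := by
  obtain ⟨n, hn⟩ := ENNReal.exists_inv_nat_lt hpos
  have hle : (ENNReal.ofReal ((n : ℝ) + 1))⁻¹ ≤ powerGain α (x k₀) (h k₀) := by
    refine le_trans (ENNReal.inv_le_inv.2 ?_) hn.le
    rw [← ENNReal.ofReal_natCast]
    exact ENNReal.ofReal_le_ofReal (by linarith)
  obtain ⟨k, hk, hmax⟩ := (hfin n).exists_maximalFor (fun k => powerGain α (x k) (h k)) _
    ⟨k₀, hk₀, hle⟩
  refine ⟨k, hk.1, fun j hj => ?_⟩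
  by_contra! hlt
  exact hlt.not_ge (hmax ⟨hj, hk.2.trans hlt.le⟩ hlt.le)

lemma minRecipGain_le_ofReal_iff
    (hfin : ∀ n : ℕ, {k | i ∈ c k ∧
      (ENNReal.ofReal ((n : ℝ) + 1))⁻¹ ≤ powerGain α (x k) (h k)}.Finite) (T : ℝ) :
    minRecipGain α x c h i ≤ ENNReal.ofReal T ↔
      ∃ k, i ∈ c k ∧ (ENNReal.ofReal T)⁻¹ ≤ powerGain α (x k) (h k) := by
  constructor
  · intro hle
    have hlt : minRecipGain α x c h i < ∞ := hle.trans_lt ENNReal.ofReal_lt_top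
    simp only [minRecipGain, iInf_lt_iff] at hlt
    obtain ⟨k₀, hk₀, hgain⟩ := hlt
    obtain ⟨k, hk, hmax⟩ := exists_isServingHelper hfin hk₀ (ENNReal.inv_lt_top.1 hgain).ne'
    refine ⟨k, hk, ENNReal.inv_le_iff_inv_le.1 (le_trans ?_ hle)⟩
    exact le_iInf₂ fun j hj => ENNReal.inv_le_inv.2 (hmax j hj)
  · rintro ⟨k, hk, hgain⟩
    exact (iInf₂_le k hk).trans (ENNReal.inv_le_iff_inv_le.1 hgain)

/-- The rate `r` is supported exactly if the reciprocal gain is at most `η / (2 ^ r - 1)`. -/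
lemma le_mutualInfo_iff {η r : ℝ} (hη : 0 < η) (hr : 0 < r) (ξ : ℝ≥0∞) :
    (r : EReal) ≤ mutualInfo η ξ ↔ ξ ≤ ENNReal.ofReal (η / ((2 : ℝ) ^ r - 1)) := by
  have hlog : 0 < Real.log 2 := Real.log_pos one_lt_two
  have h1 : 0 < (2 : ℝ) ^ r - 1 := sub_pos.2 (Real.one_lt_rpow one_lt_two hr)
  have hA : (r : EReal) * (Real.log 2 : ℝ) = ENNReal.log (1 + ENNReal.ofReal (2 ^ r - 1)) := by
    rw [← ENNReal.ofReal_one, ← ENNReal.ofReal_add zero_le_one h1.le,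
      ENNReal.log_ofReal_of_pos (by linarith), add_sub_cancel, Real.log_rpow two_pos]
    push_cast
    rfl
  rw [mutualInfo, EReal.le_div_iff_mul_le (by exact_mod_cast hlog) (EReal.coe_ne_top _), hA,
    ENNReal.log_le_log_iff, ENNReal.add_le_add_iff_left ENNReal.one_ne_top,
    ENNReal.ofReal_div_of_pos h1, ENNReal.le_div_iff_mul_le (.inr (by simpa using hη))
      (.inr ENNReal.ofReal_ne_top), ENNReal.le_div_iff_mul_le (.inl (by simpa using h1))
      (.inl ENNReal.ofReal_ne_top), mul_comm]

end Deterministic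

/-! ### Void probabilities, serving helpers and success probabilities -/

namespace IsCachingNetwork

variable {Ω : Type*} [MeasurableSpace Ω] {μ : Measure Ω}
  {F M : ℕ} {lam : ℝ≥0} {α m : ℝ} {p : Fin F → ℝ}
  {X : ℕ → Ω → Plane} {C : ℕ → Ω → Set (Fin F)} {h : ℕ → Ω → ℂ}

/-- The set of pairs (location, mark) of helpers that store `i` with gain at least `t`. -/
def goodSet (α : ℝ) (t : ℝ≥0∞) (i : Fin F) : Set (Plane × (Set (Fin F) × ℂ)) :=
  {z | i ∈ z.2.1 ∧ t ≤ powerGain α z.1 z.2.2}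

lemma measurableSet_goodSet (t : ℝ≥0∞) (i : Fin F) : MeasurableSet (goodSet α t i) := by
  have hgain : Measurable fun z : Plane × (Set (Fin F) × ℂ) => powerGain α z.1 z.2.2 := by
    unfold powerGain
    fun_prop
  have hcache : Measurable fun z : Plane × (Set (Fin F) × ℂ) => i ∈ z.2.1 :=
    (measurable_set_mem i).comp (by fun_prop)
  exact (measurableSet_setOfPred.2 hcache).inter (measurableSet_le measurable_const hgain)

lemma cacheProb_nonneg (hnet : IsCachingNetwork μ M lam m p X C h) (i : Fin F) : 0 ≤ p i :=
  hnet.cache_prob 0 i ▸ measureReal_nonneg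

lemma measurable_marks (hnet : IsCachingNetwork μ M lam m p X C h) (k : ℕ) :
    Measurable fun ω => (C k ω, h k ω) :=
  (hnet.measurable_cache k).prodMk (hnet.measurable_fading k)

variable [IsProbabilityMeasure μ]

lemma cacheProb_le_one (hnet : IsCachingNetwork μ M lam m p X C h) (i : Fin F) : p i ≤ 1 :=
  hnet.cache_prob 0 i ▸ measureReal_le_one

/-- Given its location, a helper is good with a probability that does not depend on its index. -/
lemma measure_mark_mem_goodSet (hnet : IsCachingNetwork μ M lam m p X C h) (t : ℝ≥0∞) (i : Fin F)
    (k : ℕ) (x : Plane) :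
    μ {ω | (x, (C k ω, h k ω)) ∈ goodSet α t i} = ENNReal.ofReal (p i) * gainTail α m t x := by
  have hS : MeasurableSet {s : Set (Fin F) | i ∈ s} := measurableSet_setOfPred.2 (measurable_set_mem i)
  have hV : MeasurableSet {z : ℂ | t ≤ powerGain α x z} :=
    measurableSet_le measurable_const (by unfold powerGain; fun_prop)
  have hU : MeasurableSet {u : ℝ | t ≤ ENNReal.ofReal u * ‖x‖ₑ ^ (-α)} :=
    measurableSet_le measurable_const (by fun_prop)
  calc μ {ω | (x, (C k ω, h k ω)) ∈ goodSet α t i}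
      = μ (C k ⁻¹' {s | i ∈ s}) * μ (h k ⁻¹' {z | t ≤ powerGain α x z}) :=
        (hnet.indep_cache_fading k).measure_inter_preimage_eq_mul _ _ hS hV
    _ = _ := by
        congr 1
        · rw [← hnet.cache_prob k i, ofReal_measureReal]
          rfl
        · rw [gainTail, ← (hnet.fading_law k).measure_eq hU]
          congr 1 with ω
          simp [powerGain, ENNReal.ofReal_pow]

/-- The locations may be frozen when averaging over the marks. -/
lemma measure_locations_marks_mem (hnet : IsCachingNetwork μ M lam m p X C h)
    {S : Set ((ℕ → Plane) × (ℕ → Set (Fin F) × ℂ))} (hS : MeasurableSet S) :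
    μ {ω | (fun k => X k ω, fun k => (C k ω, h k ω)) ∈ S} =
      ∫⁻ ω, μ {ω' | (fun k => X k ω, fun k => (C k ω', h k ω')) ∈ S} ∂μ := by
  have hX : Measurable fun ω k => X k ω := measurable_pi_lambda _ hnet.locations.measurable
  have hY : Measurable fun ω k => (C k ω, h k ω) := measurable_pi_lambda _ hnet.measurable_marks
  have := Measure.isProbabilityMeasure_map (μ := μ) hY.aemeasurable
  have hprod := (indepFun_iff_map_prod_eq_prod_map_map hX.aemeasurable hY.aemeasurable).1
    hnet.indep_locations
  calc _ = μ.map (fun ω => (fun k => X k ω, fun k => (C k ω, h k ω))) S :=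
        (Measure.map_apply (hX.prodMk hY) hS).symm
    _ = _ := by
        rw [hprod, Measure.prod_apply hS,
          lintegral_map (measurable_measure_prodMk_left hS) hX]
        exact lintegral_congr fun ω => Measure.map_apply hY (measurable_prodMk_left hS)

lemma measurableSet_mem_goodSet (t : ℝ≥0∞) (i : Fin F) (k : ℕ) :
    MeasurableSet {z : (ℕ → Plane) × (ℕ → Set (Fin F) × ℂ) | (z.1 k, z.2 k) ∈ goodSet α t i} :=
  (by fun_prop : Measurable fun z : (ℕ → Plane) × (ℕ → Set (Fin F) × ℂ) => (z.1 k, z.2 k))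
    (measurableSet_goodSet t i)

lemma lintegral_goodProb (hm : 0 < m) (hα : 0 < α) {T : ℝ} (hT : 0 < T) {c : ℝ} (hc : 0 ≤ c) :
    ∫⁻ x, ENNReal.ofReal c * gainTail α m (ENNReal.ofReal T)⁻¹ x = ENNReal.ofReal (c * (Real.pi *
      (Real.Gamma (2 / α + m) / (m ^ (2 / α) * Real.Gamma m)) * T ^ (2 / α))) := by
  rw [lintegral_const_mul _ (measurable_gainTail α hm _), lintegral_gainTail hα hm hT,
    ENNReal.ofReal_mul hc]

/-- By Campbell's formula and the Borel–Cantelli lemma, only finitely many helpers that store `i`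
have gain above a positive level. -/
lemma ae_finite_goodSet (hnet : IsCachingNetwork μ M lam m p X C h) (hm : 0 < m) (hα : 0 < α)
    (i : Fin F) {T : ℝ} (hT : 0 < T) :
    ∀ᵐ ω ∂μ, {k | i ∈ C k ω ∧
      (ENNReal.ofReal T)⁻¹ ≤ powerGain α (X k ω) (h k ω)}.Finite := by
  refine ae_finite_setOfPred_mem (s := fun k => {ω | (X k ω, (C k ω, h k ω)) ∈
    goodSet α (ENNReal.ofReal T)⁻¹ i}) ?_
  have hk : ∀ k, μ {ω | (X k ω, (C k ω, h k ω)) ∈ goodSet α (ENNReal.ofReal T)⁻¹ i} =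
      ∫⁻ ω, ENNReal.ofReal (p i) * gainTail α m (ENNReal.ofReal T)⁻¹ (X k ω) ∂μ := fun k =>
    (hnet.measure_locations_marks_mem (measurableSet_mem_goodSet _ i k)).trans
      (lintegral_congr fun ω => hnet.measure_mark_mem_goodSet _ i k _)
  simp_rw [hk]
  rw [hnet.locations.tsum_lintegral ((measurable_gainTail α hm _).const_mul _),
    lintegral_goodProb hm hα hT (hnet.cacheProb_nonneg i)]
  exact ENNReal.mul_ne_top ENNReal.coe_ne_top ENNReal.ofReal_ne_top

/-- The void probability: given the locations, the helpers are good independently of one another,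
so this is the probability generating functional of the locations. -/
theorem measure_forall_notMem_goodSet (hnet : IsCachingNetwork μ M lam m p X C h) (hm : 0 < m)
    (hα : 0 < α) (i : Fin F) {T : ℝ} (hT : 0 < T) :
    μ {ω | ∀ k, (X k ω, (C k ω, h k ω)) ∉ goodSet α (ENNReal.ofReal T)⁻¹ i} =
      ENNReal.ofReal (Real.exp (-(kappa lam m (2 / α) * p i * T ^ (2 / α)))) := by
  set t := (ENNReal.ofReal T)⁻¹
  have hp0 := hnet.cacheProb_nonneg i
  let q : Plane → ℝ≥0∞ := fun x => ENNReal.ofReal (p i) * gainTail α m t x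
  have hq : Measurable q := (measurable_gainTail α hm t).const_mul _
  have hq1 : ∀ x, q x ≤ 1 := fun x => mul_le_one'
    (ENNReal.ofReal_le_one.2 (hnet.cacheProb_le_one i)) (gainTail_le_one α hm t x)
  have hqint : ∫⁻ x, q x = _ := lintegral_goodProb hm hα hT hp0
  have hmeas : ∀ n : ℕ, MeasurableSet {z : (ℕ → Plane) × (ℕ → Set (Fin F) × ℂ) |
      ∀ k ∈ Finset.range n, (z.1 k, z.2 k) ∉ goodSet α t i} := fun n =>
    measurableSet_setOfPred.2 (Measurable.forall fun k => Measurable.forall fun _ =>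
      measurableSet_setOfPred.1 (measurableSet_mem_goodSet t i k).compl)
  have hfix : ∀ (n : ℕ) (x : ℕ → Plane),
      μ {ω | ∀ k ∈ Finset.range n, (x k, (C k ω, h k ω)) ∉ goodSet α t i} =
        ∏ k ∈ Finset.range n, (1 - q (x k)) := by
    intro n x
    have hsec : ∀ k, MeasurableSet {y : Set (Fin F) × ℂ | (x k, y) ∈ goodSet α t i} := fun k =>
      measurable_prodMk_left (measurableSet_goodSet t i)
    have hind := hnet.indep_helpers.measure_inter_preimage_eq_mul (Finset.range n)
      (sets := fun k => {y | (x k, y) ∈ goodSet α t i}ᶜ) fun k _ => (hsec k).compl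
    calc _ = μ (⋂ k ∈ Finset.range n, (fun ω => (C k ω, h k ω)) ⁻¹'
            {y | (x k, y) ∈ goodSet α t i}ᶜ) := by
          congr 1 with ω
          simp
      _ = _ := by
          rw [hind]
          refine Finset.prod_congr rfl fun k _ => ?_
          rw [Set.preimage_compl, prob_compl_eq_one_sub (hnet.measurable_marks k (hsec k))]
          exact congrArg (1 - ·) (hnet.measure_mark_mem_goodSet t i k (x k))
  let D : ℕ → Set Ω := fun n =>
    {ω | ∀ k ∈ Finset.range n, (X k ω, (C k ω, h k ω)) ∉ goodSet α t i}
  have hpre : ∀ k, MeasurableSet {ω | (X k ω, (C k ω, h k ω)) ∈ goodSet α t i} := fun k =>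
    ((hnet.locations.measurable k).prodMk (hnet.measurable_marks k)) (measurableSet_goodSet t i)
  have hDanti : Antitone D := fun n n' hn ω hω k hk => hω k (Finset.range_mono hn hk)
  have hDmeas : ∀ n, MeasurableSet (D n) := fun n => by
    have hX : Measurable fun ω k => X k ω := measurable_pi_lambda _ hnet.locations.measurable
    have hY : Measurable fun ω k => (C k ω, h k ω) := measurable_pi_lambda _ hnet.measurable_marks
    exact (hX.prodMk hY) (hmeas n)
  have hD : ∀ n, μ (D n) = ∫⁻ ω, ∏ k ∈ Finset.range n, (1 - q (X k ω)) ∂μ := fun n =>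
    (hnet.measure_locations_marks_mem (hmeas n)).trans (lintegral_congr fun ω => hfix n _)
  calc _ = μ (⋂ n, D n) := by
        congr 1 with ω
        simp only [D, Set.mem_ofPred_eq, Set.mem_iInter, Finset.mem_range]
        exact ⟨fun hω n k _ => hω k, fun hω k => hω (k + 1) k k.lt_succ_self⟩
    _ = ⨅ n, ∫⁻ ω, ∏ k ∈ Finset.range n, (1 - q (X k ω)) ∂μ := by
        rw [hDanti.measure_iInter (fun n => (hDmeas n).nullMeasurableSet) ⟨0, measure_ne_top _ _⟩]
        exact iInf_congr hD
    _ = ∫⁻ ω, ⨅ n : ℕ, ∏ k ∈ Finset.range n, (1 - q (X k ω)) ∂μ := by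
        refine (lintegral_iInf (fun n => ?_) ?_ (by simp)).symm
        · exact Finset.measurable_fun_prod _ fun k _ =>
            measurable_const.sub (hq.comp (hnet.locations.measurable k))
        · exact antitone_nat_of_succ_le fun n ω => by
            simp only [Finset.prod_range_succ]
            exact mul_le_of_le_one_right' tsub_le_self
    _ = _ := by
        have hG : 0 < Real.Gamma m := Real.Gamma_pos_of_pos hm
        have hG' : 0 < Real.Gamma (2 / α + m) := Real.Gamma_pos_of_pos (by positivity)
        rw [hnet.locations.lintegral_iInf_prod_one_sub hq hq1 (hqint ▸ ENNReal.ofReal_ne_top),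
          hqint, ENNReal.toReal_ofReal (by positivity), kappa]
        congr 3
        ring

lemma ae_forall_finite_goodSet (hnet : IsCachingNetwork μ M lam m p X C h) (hm : 0 < m)
    (hα : 0 < α) (i : Fin F) :
    ∀ᵐ ω ∂μ, ∀ n : ℕ, {k | i ∈ C k ω ∧
      (ENNReal.ofReal ((n : ℝ) + 1))⁻¹ ≤ powerGain α (X k ω) (h k ω)}.Finite :=
  ae_all_iff.2 fun n => hnet.ae_finite_goodSet hm hα i (by positivity)

theorem ae_exists_isServingHelper (hnet : IsCachingNetwork μ M lam m p X C h) (hm : 0 < m)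
    (hα : 0 < α) (hlam : 0 < lam) {i : Fin F} (hp : 0 < p i) :
    ∀ᵐ ω ∂μ, ∃ k,
      IsServingHelper α (fun k => X k ω) (fun k => C k ω) (fun k => h k ω) i k := by
  have hκ : 0 < kappa lam m (2 / α) := by
    have hG : 0 < Real.Gamma m := Real.Gamma_pos_of_pos hm
    have hG' : 0 < Real.Gamma (2 / α + m) := Real.Gamma_pos_of_pos (by positivity)
    have : (0 : ℝ) < lam := hlam
    unfold kappa
    positivity
  have hpos : ∀ᵐ ω ∂μ, ∃ k, i ∈ C k ω ∧ powerGain α (X k ω) (h k ω) ≠ 0 := by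
    rw [ae_iff]
    have hlim : Tendsto (fun T : ℝ => ENNReal.ofReal
        (Real.exp (-(kappa lam m (2 / α) * p i * T ^ (2 / α))))) atTop (𝓝 0) := by
      rw [← ENNReal.ofReal_zero]
      refine ENNReal.tendsto_ofReal (Real.tendsto_exp_neg_atTop_nhds_zero.comp ?_)
      exact (tendsto_rpow_atTop (by positivity)).const_mul_atTop (by positivity)
    refine le_antisymm (ge_of_tendsto hlim ?_) zero_le
    filter_upwards [eventually_gt_atTop 0] with T hT
    rw [← hnet.measure_forall_notMem_goodSet hm hα i hT]
    refine measure_mono fun ω hω k hk => hω ⟨k, hk.1, fun h0 => ?_⟩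
    have := hk.2
    simp [h0] at this
  filter_upwards [hpos, hnet.ae_forall_finite_goodSet hm hα i] with ω ⟨k, hk, hk'⟩ hfin
  exact exists_isServingHelper hfin hk hk'

theorem measureReal_le_mutualInfo (hnet : IsCachingNetwork μ M lam m p X C h) (hm : 0 < m)
    (hα : 0 < α) (i : Fin F) {η r : ℝ} (hη : 0 < η) (hr : 0 < r) :
    μ.real {ω | (r : EReal) ≤
      mutualInfo η (minRecipGain α (fun k => X k ω) (fun k => C k ω) (fun k => h k ω) i)} =
      1 - Real.exp (-(kappa lam m (2 / α) * p i * (η / ((2 : ℝ) ^ r - 1)) ^ (2 / α))) := by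
  have hT : 0 < η / ((2 : ℝ) ^ r - 1) :=
    div_pos hη (sub_pos.2 (Real.one_lt_rpow one_lt_two hr))
  set T := η / ((2 : ℝ) ^ r - 1)
  let V : Set Ω := {ω | ∀ k, (X k ω, (C k ω, h k ω)) ∉ goodSet α (ENNReal.ofReal T)⁻¹ i}
  have hV : MeasurableSet V := by
    refine measurableSet_setOfPred.2 (Measurable.forall fun k => measurableSet_setOfPred.1 ?_)
    exact (((hnet.locations.measurable k).prodMk (hnet.measurable_marks k))
      (measurableSet_goodSet _ i)).compl
  have hae : {ω | (r : EReal) ≤ mutualInfo η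
      (minRecipGain α (fun k => X k ω) (fun k => C k ω) (fun k => h k ω) i)} =ᵐ[μ] (Vᶜ : Set Ω) := by
    filter_upwards [hnet.ae_forall_finite_goodSet hm hα i] with ω hfin
    refine propext ((le_mutualInfo_iff hη hr _).trans ((minRecipGain_le_ofReal_iff hfin T).trans ?_))
    change _ ↔ ¬ ∀ k, (X k ω, (C k ω, h k ω)) ∉ goodSet α (ENNReal.ofReal T)⁻¹ i
    push Not
    rfl
  rw [measureReal_congr hae, probReal_compl_eq_one_sub hV, measureReal_def,
    hnet.measure_forall_notMem_goodSet hm hα i hT, ENNReal.toReal_ofReal (Real.exp_pos _).le]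

end IsCachingNetwork

theorem theorem1 {Ω : Type*} [MeasurableSpace Ω] (μ : Measure Ω) [IsProbabilityMeasure μ]
    {F : ℕ} (M : ℕ) (lam : ℝ≥0) (α m P σ : ℝ) (f p ρ : Fin F → ℝ)
    (X : ℕ → Ω → Plane) (C : ℕ → Ω → Set (Fin F)) (h : ℕ → Ω → ℂ)
    (hlam : 0 < lam) (hα : 2 < α) (hm : 1 / 2 ≤ m) (hP : 0 < P) (hσ : 0 < σ)
    (hf : ∀ i, 0 ≤ f i) (hf1 : ∑ i, f i = 1) (hρ : ∀ i, 0 < ρ i)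
    (hnet : IsCachingNetwork μ M lam m p X C h) :
    (∀ i, 0 < p i → ∀ᵐ ω ∂μ, ∃ k,
      IsServingHelper α (fun k => X k ω) (fun k => C k ω) (fun k => h k ω) i k) ∧
    avgSuccessProb μ α (P / σ ^ 2) f ρ X C h =
      1 - ∑ i, f i * Real.exp
        (-(kappa lam m (2 / α) * p i * (P / σ ^ 2 / ((2 : ℝ) ^ ρ i - 1)) ^ (2 / α))) := by
  have hα0 : 0 < α := by linarith
  have hm0 : 0 < m := by linarith
  refine ⟨fun i hi => hnet.ae_exists_isServingHelper hm0 hα0 hlam hi, ?_⟩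
  simp_rw [avgSuccessProb,
    fun i => hnet.measureReal_le_mutualInfo hm0 hα0 i (η := P / σ ^ 2) (by positivity) (hρ i)]
  simp only [mul_sub, mul_one, Finset.sum_sub_distrib, hf1]
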